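/- Let $\mathbb N=\{1,2,\dots\}$ and $\mathbb N_0=\mathbb N\cup\{0\}$. Let \[ s=\Big\{\xi\in\mathbb C^{\mathbb N}:\ |\xi|_q:=\Big(\sum_{j=1}^\infty|\xi_j|^2j^{2q}\Big)^{1/2}<\infty\ \text{ for all } q\in\mathbb N_0\Big\} \] be the space of rapidly decreasing sequences with the topology given by the norms $(|\cdot|_q)_{q\in\mathbb N_0}$, and for a sequence $(n_k)_{k\in\mathbb N}$ of positive integers let \[ \lambda^\infty(n_k^q)=\Big\{\xi\in\mathbb C^{\mathbb N}:\ |\xi|_{\infty,q}:=\sup_{k\in\mathbb N}|\xi_k|\,n_k^q<\infty\ \text{ for all } q\in\mathbb N_0\Big\} \] with the topology given by the norms $(|\cdot|_{\infty,q})_{q\in\mathbb N_0}$. With pointwise multiplication and complex conjugation both are Fréchet ${}^*$-algebras. An isomorphism of Fréchet ${}^*$-algebras is a linear, multiplicative, ${}^*$-preserving bijection that is a homeomorphism; subalgebras of $s$ need not be unital and carry the subspace topology. (1) Every infinite-dimensional closed ${}^*$-subalgebra of $s$ is isomorphic as a Fréchet ${}^*$-algebra to $\lambda^\infty(n_k^q)$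 for some strictly increasing sequence $(n_k)_{k\in\mathbb N}$ of positive integers. (2) Conversely, for every strictly increasing sequence $(n_k)_{k\in\mathbb N}$ of positive integers, $\lambda^\infty(n_k^q)$ is isomorphic as a Fréchet ${}^*$-algebra to some infinite-dimensional closed ${}^*$-subalgebra of $s$. (3) Every closed ${}^*$-subalgebra $E$ of $s$ (of finite or infinite dimension) is a complemented subspace of $s$, i.e. there is a continuous linear projection of $s$ onto $E$. -/

import Mathlib

noncomputable section

/-! ### The space `s` of rapidly decreasing sequences

Sequences are indexed by the positive integers `ℕ+`. All algebra operations on sequences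
(multiplication, conjugation) are pointwise, i.e. those of `ℕ+ → ℂ`. -/

namespace RapidSeq

theorem sq_norm_le {ξ : ℕ+ → ℂ}
    (h : ∀ q : ℕ, Summable fun j : ℕ+ => ‖ξ j‖ ^ 2 * (j : ℝ) ^ (2 * q)) (j : ℕ+) :
    ‖ξ j‖ ^ 2 ≤ ∑' i : ℕ+, ‖ξ i‖ ^ 2 := by
  have h0 : Summable fun i : ℕ+ => ‖ξ i‖ ^ 2 := by simpa using h 0
  exact h0.le_tsum j fun i _ => by positivity

/-- The sequences `ξ` with `∑ |ξ_j|² j^{2q} < ∞` for all `q ∈ ℕ₀`, as a `*`-subalgebra of the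
algebra of all sequences. -/
def carrier : NonUnitalStarSubalgebra ℂ (ℕ+ → ℂ) where
  carrier := {ξ | ∀ q : ℕ, Summable fun j : ℕ+ => ‖ξ j‖ ^ 2 * (j : ℝ) ^ (2 * q)}
  zero_mem' := fun q => by simp
  add_mem' := by
    intro ξ η hξ hη q
    refine Summable.of_nonneg_of_le (fun j => by positivity) (fun j => ?_)
      (((hξ q).add (hη q)).mul_left 2)
    have h1 : ‖(ξ + η) j‖ ^ 2 ≤ 2 * (‖ξ j‖ ^ 2 + ‖η j‖ ^ 2) := by
      have h2 : ‖(ξ + η) j‖ ≤ ‖ξ j‖ + ‖η j‖ := norm_add_le _ _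
      nlinarith [sq_nonneg (‖ξ j‖ - ‖η j‖), norm_nonneg ((ξ + η) j)]
    calc ‖(ξ + η) j‖ ^ 2 * (j : ℝ) ^ (2 * q)
        ≤ (2 * (‖ξ j‖ ^ 2 + ‖η j‖ ^ 2)) * (j : ℝ) ^ (2 * q) :=
          mul_le_mul_of_nonneg_right h1 (by positivity)
      _ = _ := by ring
  smul_mem' := by
    intro c ξ hξ q
    refine ((hξ q).mul_left (‖c‖ ^ 2)).congr fun j => ?_
    simp only [Pi.smul_apply, norm_smul]
    ring
  mul_mem' := by
    intro ξ η hξ hη q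
    refine Summable.of_nonneg_of_le (fun j => by positivity) (fun j => ?_)
      ((hη q).mul_left (∑' i : ℕ+, ‖ξ i‖ ^ 2))
    have h1 := sq_norm_le hξ j
    simp only [Pi.mul_apply, norm_mul, mul_pow, mul_assoc]
    exact mul_le_mul_of_nonneg_right h1 (by positivity)
  star_mem' := by
    intro ξ hξ q
    simpa using hξ q

end RapidSeq

/-- The space `s` of rapidly decreasing sequences. It is a separate type, so that it does not
inherit the topology of pointwise convergence from `ℕ+ → ℂ`. -/
def RapidSeq : Type := RapidSeq.carrier

namespace RapidSeq

instance : NonUnitalCommRing RapidSeq := inferInstanceAs (NonUnitalCommRing carrier)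
instance : Module ℂ RapidSeq := inferInstanceAs (Module ℂ carrier)
instance : StarRing RapidSeq := inferInstanceAs (StarRing carrier)

instance : CoeFun RapidSeq (fun _ => ℕ+ → ℂ) := ⟨fun ξ => ξ.1⟩

/-- The norm `|ξ|_q = (∑ |ξ_j|² j^{2q})^{1/2}` on `s`. -/
def seminorm : SeminormFamily ℂ RapidSeq ℕ := fun q =>
  Seminorm.of (fun ξ => Real.sqrt (∑' j : ℕ+, ‖ξ j‖ ^ 2 * (j : ℝ) ^ (2 * q)))
    (by
      intro ξ η
      have key : ∀ (ζ : RapidSeq) (j : ℕ+),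
          (‖ζ j‖ * (j : ℝ) ^ q) ^ (2 : ℝ) = ‖ζ j‖ ^ 2 * (j : ℝ) ^ (2 * q) := by
        intro ζ j
        rw [Real.rpow_two]
        ring
      have hs : ∀ ζ : RapidSeq, Summable fun j : ℕ+ => (‖ζ j‖ * (j : ℝ) ^ q) ^ (2 : ℝ) :=
        fun ζ => (ζ.2 q).congr fun j => (key ζ j).symm
      have M := Real.Lp_add_le_tsum_of_nonneg (p := 2) (by norm_num)
        (f := fun j : ℕ+ => ‖ξ j‖ * (j : ℝ) ^ q) (g := fun j : ℕ+ => ‖η j‖ * (j : ℝ) ^ q)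
        (fun j => by positivity) (fun j => by positivity) (hs ξ) (hs η)
      simp only [key, ← Real.sqrt_eq_rpow] at M
      refine le_trans (Real.sqrt_le_sqrt ?_) M.2
      refine ((ξ + η).2 q).tsum_le_tsum (fun j => ?_) M.1
      rw [← key]
      refine Real.rpow_le_rpow (by positivity) ?_ (by norm_num)
      rw [← add_mul]
      exact mul_le_mul_of_nonneg_right (norm_add_le (ξ j) (η j)) (by positivity))
    (by
      intro c ξ
      have h : ∀ j : ℕ+, ‖(c • ξ) j‖ ^ 2 * (j : ℝ) ^ (2 * q)
          = ‖c‖ ^ 2 * (‖ξ j‖ ^ 2 * (j : ℝ) ^ (2 * q)) := by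
        intro j
        have : (c • ξ) j = c * ξ j := rfl
        rw [this, norm_mul]
        ring
      simp only [h, tsum_mul_left]
      rw [Real.sqrt_mul (by positivity), Real.sqrt_sq (norm_nonneg c)])

/-- The topology of `s` is the one given by the norms `|·|_q`, `q ∈ ℕ₀`. -/
instance : TopologicalSpace RapidSeq := seminorm.moduleFilterBasis.topology

end RapidSeq

/-! ### Köthe spaces `λ^∞(A)` -/

/-- A Köthe matrix `(a_{j,q})`, `j ∈ ℕ`, `q ∈ ℕ₀`. -/
structure KotheMatrix where
  entry : ℕ+ → ℕ → ℝ
  nonneg : ∀ j q, 0 ≤ entry j q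
  exists_pos : ∀ j, ∃ q, 0 < entry j q
  mono : ∀ j q, entry j q ≤ entry j (q + 1)

namespace KotheMatrix

/-- All the entries of the matrix are at least `1`. Then `λ^∞(A)` is closed under pointwise
multiplication. -/
class OneLE (A : KotheMatrix) : Prop where
  one_le : ∀ j q, 1 ≤ A.entry j q

/-- The Köthe matrix `(n_k^q)` of a sequence `n` of positive integers. -/
def powers (n : ℕ+ → ℕ+) : KotheMatrix where
  entry := fun k q => (n k : ℝ) ^ q
  nonneg := fun k q => by positivity
  exists_pos := fun k => ⟨0, by simp⟩
  mono := fun k q => pow_le_pow_right₀ (by exact_mod_cast (n k).pos) (Nat.le_succ q)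

instance (n : ℕ+ → ℕ+) : (powers n).OneLE :=
  ⟨fun k _ => one_le_pow₀ (by exact_mod_cast (n k).pos)⟩

end KotheMatrix

namespace LambdaInf

/-- The sequences `ξ` with `sup_j |ξ_j| a_{j,q} < ∞` for all `q ∈ ℕ₀`. -/
def carrier (A : KotheMatrix) : Submodule ℂ (ℕ+ → ℂ) where
  carrier := {ξ | ∀ q : ℕ, BddAbove (Set.range fun j : ℕ+ => ‖ξ j‖ * A.entry j q)}
  zero_mem' := fun q => ⟨0, by rintro _ ⟨j, rfl⟩; simp⟩
  add_mem' := by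
    intro ξ η hξ hη q
    obtain ⟨C, hC⟩ := hξ q
    obtain ⟨D, hD⟩ := hη q
    refine ⟨C + D, ?_⟩
    rintro _ ⟨j, rfl⟩
    have h1 : ‖ξ j‖ * A.entry j q ≤ C := hC ⟨j, rfl⟩
    have h2 : ‖η j‖ * A.entry j q ≤ D := hD ⟨j, rfl⟩
    have h3 : ‖(ξ + η) j‖ ≤ ‖ξ j‖ + ‖η j‖ := norm_add_le _ _
    have h4 := mul_le_mul_of_nonneg_right h3 (A.nonneg j q)
    simp only
    linarith
  smul_mem' := by
    intro c ξ hξ q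
    obtain ⟨C, hC⟩ := hξ q
    refine ⟨‖c‖ * C, ?_⟩
    rintro _ ⟨j, rfl⟩
    have h1 : ‖ξ j‖ * A.entry j q ≤ C := hC ⟨j, rfl⟩
    simp only [Pi.smul_apply, norm_smul, mul_assoc]
    exact mul_le_mul_of_nonneg_left h1 (norm_nonneg c)

/-- If the entries of `A` are at least `1`, the space `λ^∞(A)` as a `*`-subalgebra of the algebra
of all sequences. -/
def carrierAlg (A : KotheMatrix) [A.OneLE] : NonUnitalStarSubalgebra ℂ (ℕ+ → ℂ) where
  toSubmodule := carrier A
  mul_mem' := by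
    intro ξ η hξ hη q
    obtain ⟨C, hC⟩ := hξ q
    obtain ⟨D, hD⟩ := hη q
    refine ⟨C * D, ?_⟩
    rintro _ ⟨j, rfl⟩
    have h1 : ‖ξ j‖ * A.entry j q ≤ C := hC ⟨j, rfl⟩
    have h2 : ‖η j‖ * A.entry j q ≤ D := hD ⟨j, rfl⟩
    have h3 : ‖ξ j‖ ≤ ‖ξ j‖ * A.entry j q :=
      le_mul_of_one_le_right (norm_nonneg _) (KotheMatrix.OneLE.one_le j q)
    simp only [Pi.mul_apply, norm_mul, mul_assoc]
    exact mul_le_mul (h3.trans h1) h2 (mul_nonneg (norm_nonneg _) (A.nonneg j q))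
      ((norm_nonneg _).trans (h3.trans h1))
  star_mem' := by
    intro ξ hξ q
    simpa using hξ q

end LambdaInf

/-- The Köthe space `λ^∞(A)`, a separate type for the same reason as `RapidSeq`. -/
def LambdaInf (A : KotheMatrix) : Type := LambdaInf.carrier A

namespace LambdaInf

variable (A : KotheMatrix)

instance : AddCommGroup (LambdaInf A) := inferInstanceAs (AddCommGroup (carrier A))
instance : Module ℂ (LambdaInf A) := inferInstanceAs (Module ℂ (carrier A))

instance : CoeFun (LambdaInf A) (fun _ => ℕ+ → ℂ) := ⟨fun ξ => ξ.1⟩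

instance [A.OneLE] : NonUnitalCommRing (LambdaInf A) :=
  inferInstanceAs (NonUnitalCommRing (carrierAlg A))
instance [A.OneLE] : StarRing (LambdaInf A) := inferInstanceAs (StarRing (carrierAlg A))

/-- The seminorm `|ξ|_{∞,q} = sup_j |ξ_j| a_{j,q}` on `λ^∞(A)`. -/
def seminorm : SeminormFamily ℂ (LambdaInf A) ℕ := fun q =>
  Seminorm.of (fun ξ => ⨆ j : ℕ+, ‖ξ j‖ * A.entry j q)
    (by
      intro ξ η
      refine ciSup_le fun j => ?_
      have h3 : ‖(ξ + η) j‖ ≤ ‖ξ j‖ + ‖η j‖ := norm_add_le (ξ j) (η j)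
      calc ‖(ξ + η) j‖ * A.entry j q ≤ (‖ξ j‖ + ‖η j‖) * A.entry j q :=
            mul_le_mul_of_nonneg_right h3 (A.nonneg j q)
        _ = ‖ξ j‖ * A.entry j q + ‖η j‖ * A.entry j q := add_mul _ _ _
        _ ≤ _ := add_le_add (le_ciSup (ξ.2 q) j) (le_ciSup (η.2 q) j))
    (by
      intro c ξ
      rw [Real.mul_iSup_of_nonneg (norm_nonneg c)]
      congr 1
      funext j
      have : (c • ξ) j = c * ξ j := rfl
      rw [this, norm_mul, mul_assoc])

/-- The topology of `λ^∞(A)` is the one given by the seminorms `|·|_{∞,q}`, `q ∈ ℕ₀`. -/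
instance : TopologicalSpace (LambdaInf A) := (seminorm A).moduleFilterBasis.topology

end LambdaInf

/-! ### Isomorphisms -/

/-- `X` and `Y` are isomorphic as topological (in particular, as Fréchet) `*`-algebras: there is
a linear, multiplicative, `*`-preserving bijection which is a homeomorphism. -/
def FrechetStarIso (X Y : Type*) [NonUnitalRing X] [StarRing X] [Module ℂ X] [TopologicalSpace X]
    [NonUnitalRing Y] [StarRing Y] [Module ℂ Y] [TopologicalSpace Y] : Prop :=
  ∃ Φ : X ≃⋆ₐ[ℂ] Y, Continuous Φ ∧ Continuous Φ.symm

end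

/-!
For a closed subalgebra `E` of `s` call two indices equivalent if no element of `E` separates them.
Where `E` does not vanish identically the equivalence classes are finite, since the elements of `s`
tend to zero, and the indicator of each such class lies in `E` as a limit of products `ξ ^ m * ζ`.
An element of `s` that is constant on these classes and vanishes elsewhere is the unconditional sum
of its multiples of indicators, so these sequences are exactly the elements of `E`. In particular
`E` is closed under conjugation.

Such a sequence is determined by its values at the largest elements `n_k` of the classes. As
`j ≤ n_k` for every `j` in the `k`-th class, the weights `j ^ q` on the class are dominated by
`n_k ^ q`, so that both the restriction `s → λ^∞(n_k^q)` and the extension by constants on the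
classes are continuous.
-/

open Filter Topology

theorem continuous_of_seminorm_le {𝕜 X Y ι ι' : Type*} [NormedField 𝕜]
    [AddCommGroup X] [Module 𝕜 X] [TopologicalSpace X]
    [AddCommGroup Y] [Module 𝕜 Y] [TopologicalSpace Y]
    {p : SeminormFamily 𝕜 X ι} {p' : SeminormFamily 𝕜 Y ι'} (hp : WithSeminorms p)
    (hp' : WithSeminorms p') (f : X →ₗ[𝕜] Y)
    (h : ∀ q, ∃ (r : ι) (C : ℝ), ∀ x, p' q (f x) ≤ C * p r x) : Continuous f := by
  refine hp.continuous_of_isBounded hp' f (Seminorm.IsBounded.of_real fun q => ?_)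
  obtain ⟨r, C, hr⟩ := h q
  exact ⟨{r}, C, by simpa only [Finset.sup_singleton] using hr⟩

theorem exists_strictMono_range_eq {T : Set ℕ+} (hT : T.Infinite) :
    ∃ n : ℕ+ → ℕ+, StrictMono n ∧ Set.range n = T := by
  classical
  let f := OrderIso.pnatIsoNat
  have : Infinite (f '' T) := (hT.image f.injective.injOn).to_subtype
  let g := Nat.orderEmbeddingOfSet (f '' T)
  refine ⟨f.symm ∘ g ∘ f, f.symm.strictMono.comp (g.strictMono.comp f.strictMono), ?_⟩
  rw [Set.range_comp, f.surjective.range_comp, Nat.orderEmbeddingOfSet_range, f.symm_image_image]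

namespace LambdaInf

variable {A : KotheMatrix}

@[ext]
theorem ext {ξ η : LambdaInf A} (h : ∀ j, ξ j = η j) : ξ = η := Subtype.ext (funext h)

theorem withSeminorms : WithSeminorms (seminorm A) := ⟨rfl⟩

theorem norm_mul_entry_le_seminorm (q : ℕ) (ξ : LambdaInf A) (j : ℕ+) :
    ‖ξ j‖ * A.entry j q ≤ seminorm A q ξ := le_ciSup (ξ.2 q) j

end LambdaInf

namespace RapidSeq

@[ext]
theorem ext {ξ η : RapidSeq} (h : ∀ j, ξ j = η j) : ξ = η := Subtype.ext (funext h)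

@[simp] theorem add_apply (ξ η : RapidSeq) (j : ℕ+) : (ξ + η) j = ξ j + η j := rfl
@[simp] theorem sub_apply (ξ η : RapidSeq) (j : ℕ+) : (ξ - η) j = ξ j - η j := rfl
@[simp] theorem smul_apply (c : ℂ) (ξ : RapidSeq) (j : ℕ+) : (c • ξ) j = c * ξ j := rfl
@[simp] theorem mul_apply (ξ η : RapidSeq) (j : ℕ+) : (ξ * η) j = ξ j * η j := rfl
@[simp] theorem star_apply (ξ : RapidSeq) (j : ℕ+) : (star ξ) j = star (ξ j) := rfl

theorem iterate_mul_apply (ξ ζ : RapidSeq) (m : ℕ) (j : ℕ+) :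
    ((ξ * ·)^[m] ζ) j = ξ j ^ m * ζ j := by
  induction m with
  | zero => simp only [Function.iterate_zero, id_eq, pow_zero, one_mul]
  | succ m ih => rw [Function.iterate_succ_apply', mul_apply, ih, pow_succ', mul_assoc]

/-! ### The topology of `s` -/

theorem withSeminorms : WithSeminorms seminorm := ⟨rfl⟩

theorem seminorm_apply (q : ℕ) (ξ : RapidSeq) :
    seminorm q ξ = √(∑' j : ℕ+, ‖ξ j‖ ^ 2 * (j : ℝ) ^ (2 * q)) := rfl

theorem norm_mul_pow_le_seminorm (q : ℕ) (ξ : RapidSeq) (j : ℕ+) :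
    ‖ξ j‖ * (j : ℝ) ^ q ≤ seminorm q ξ := by
  refine Real.le_sqrt_of_sq_le ?_
  calc (‖ξ j‖ * (j : ℝ) ^ q) ^ 2 = ‖ξ j‖ ^ 2 * (j : ℝ) ^ (2 * q) := by ring
    _ ≤ _ := (ξ.2 q).le_tsum j fun i _ => by positivity

theorem summable_inv_sq : Summable fun j : ℕ+ => ((j : ℝ) ^ 2)⁻¹ :=
  (Real.summable_nat_pow_inv.2 one_lt_two).comp_injective PNat.coe_injective

theorem sq_mul_pow_le_mul_inv_sq {x C : ℝ} {q : ℕ} {j : ℕ+} (hx : 0 ≤ x)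
    (h : x * (j : ℝ) ^ (q + 1) ≤ C) : x ^ 2 * (j : ℝ) ^ (2 * q) ≤ C ^ 2 * ((j : ℝ) ^ 2)⁻¹ := by
  rw [← div_eq_mul_inv, le_div_iff₀ (pow_pos (by exact_mod_cast j.pos) 2)]
  calc x ^ 2 * (j : ℝ) ^ (2 * q) * (j : ℝ) ^ 2 = (x * (j : ℝ) ^ (q + 1)) ^ 2 := by ring
    _ ≤ C ^ 2 := by gcongr

theorem mem_carrier_of_norm_mul_pow_le {f : ℕ+ → ℂ}
    (h : ∀ q : ℕ, ∃ C : ℝ, ∀ j : ℕ+, ‖f j‖ * (j : ℝ) ^ q ≤ C) : f ∈ carrier := fun q => by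
  obtain ⟨C, hC⟩ := h (q + 1)
  exact .of_nonneg_of_le (fun j => by positivity)
    (fun j => sq_mul_pow_le_mul_inv_sq (norm_nonneg _) (hC j)) (summable_inv_sq.mul_left (C ^ 2))

theorem seminorm_le_of_norm_mul_pow_le {q : ℕ} {ξ : RapidSeq} {C : ℝ} (hC : 0 ≤ C)
    (h : ∀ j : ℕ+, ‖ξ j‖ * (j : ℝ) ^ (q + 1) ≤ C) :
    seminorm q ξ ≤ √(∑' j : ℕ+, ((j : ℝ) ^ 2)⁻¹) * C := by
  rw [seminorm_apply, mul_comm _ C, ← Real.sqrt_sq hC, ← Real.sqrt_mul (sq_nonneg C),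
    ← tsum_mul_left]
  exact Real.sqrt_le_sqrt ((ξ.2 q).tsum_le_tsum
    (fun j => sq_mul_pow_le_mul_inv_sq (norm_nonneg _) (h j)) (summable_inv_sq.mul_left (C ^ 2)))

/-- Evaluation at the index `j` as a linear functional on `s`. -/
def evalₗ (j : ℕ+) : RapidSeq →ₗ[ℂ] ℂ where
  toFun ξ := ξ j
  map_add' _ _ := rfl
  map_smul' _ _ := rfl

theorem continuous_apply (j : ℕ+) : Continuous fun ξ : RapidSeq => ξ j :=
  continuous_of_seminorm_le withSeminorms (norm_withSeminorms ℂ ℂ) (evalₗ j) fun _ =>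
    ⟨0, 1, fun ξ => by
      have h := norm_mul_pow_le_seminorm 0 ξ j
      rwa [pow_zero, mul_one, ← one_mul (seminorm 0 ξ)] at h⟩

theorem sum_apply {ι : Type*} (t : Finset ι) (u : ι → RapidSeq) (j : ℕ+) :
    (∑ i ∈ t, u i) j = ∑ i ∈ t, u i j :=
  map_sum (evalₗ j) u t

theorem finite_le_norm (ξ : RapidSeq) {ε : ℝ} (hε : 0 < ε) : {j : ℕ+ | ε ≤ ‖ξ j‖}.Finite := by
  have hlim : Tendsto (fun j : ℕ+ => ‖ξ j‖ ^ 2) cofinite (𝓝 0) := by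
    simpa using (ξ.2 0).tendsto_cofinite_zero
  refine (hlim.eventually (gt_mem_nhds (pow_pos hε 2))).subset fun j hj => ?_
  exact not_lt.2 (pow_le_pow_left₀ hε.le hj 2)

theorem tendsto_of_dominated {ι : Type*} {l : Filter ι} {u : ι → RapidSeq} {ξ η : RapidSeq}
    (hlim : ∀ j, Tendsto (fun i => u i j) l (𝓝 (ξ j)))
    (hbound : ∀ᶠ i in l, ∀ j, ‖u i j‖ ≤ ‖η j‖) : Tendsto u l (𝓝 ξ) := by
  refine (withSeminorms.tendsto_nhds u ξ).2 fun q ε hε => ?_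
  have hsum : Tendsto (fun i => ∑' j : ℕ+, ‖(u i - ξ) j‖ ^ 2 * (j : ℝ) ^ (2 * q)) l (𝓝 0) := by
    rw [← tsum_zero (L := .unconditional ℕ+)]
    refine tendsto_tsum_of_dominated_convergence (((η.2 q).add (ξ.2 q)).mul_left 2)
      (fun j => ?_) (hbound.mono fun i hi j => ?_)
    · simpa using (((hlim j).sub_const (ξ j)).norm.pow 2).mul_const ((j : ℝ) ^ (2 * q))
    · have hsq : ‖(u i - ξ) j‖ ^ 2 ≤ 2 * (‖η j‖ ^ 2 + ‖ξ j‖ ^ 2) :=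
        calc ‖(u i - ξ) j‖ ^ 2 ≤ (‖η j‖ + ‖ξ j‖) ^ 2 := by
              gcongr
              exact (norm_sub_le _ _).trans (add_le_add_left (hi j) _)
          _ ≤ _ := add_sq_le
      rw [Real.norm_of_nonneg (by positivity), ← add_mul, ← mul_assoc]
      gcongr
  have hsqrt := hsum.sqrt
  rw [Real.sqrt_zero] at hsqrt
  exact hsqrt.eventually (gt_mem_nhds hε)

theorem hasSum_of_hasSum_apply {ι : Type*} {u : ι → RapidSeq} {ξ η : RapidSeq}
    (hsum : ∀ j, HasSum (fun i => u i j) (ξ j)) (hnorm : ∀ j, HasSum (fun i => ‖u i j‖) ‖η j‖) :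
    HasSum u ξ := by
  refine tendsto_of_dominated (η := η) (fun j => ?_) (.of_forall fun t j => ?_)
  · simp only [sum_apply]
    exact hsum j
  · rw [sum_apply]
    exact (norm_sum_le _ _).trans (sum_le_hasSum t (fun _ _ => norm_nonneg _) (hnorm j))

/-! ### Indicator sequences -/

/-- The indicator sequence of a finite set of indices, an idempotent of `s`. -/
noncomputable def indicator {T : Set ℕ+} (hT : T.Finite) : RapidSeq :=
  ⟨T.indicator 1, fun q => summable_of_hasFiniteSupport <| hT.subset fun j hj => by
    by_contra h
    simp [h] at hj⟩

theorem indicator_of_mem {T : Set ℕ+} (hT : T.Finite) {j : ℕ+} (hj : j ∈ T) :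
    indicator hT j = 1 := Set.indicator_of_mem hj _

theorem indicator_of_notMem {T : Set ℕ+} (hT : T.Finite) {j : ℕ+} (hj : j ∉ T) :
    indicator hT j = 0 := Set.indicator_of_notMem hj _

theorem tendsto_iterate_mul_indicator {ξ ζ : RapidSeq} {T : Set ℕ+} (hT : T.Finite)
    (h_one : ∀ j ∈ T, ξ j = 1 ∧ ζ j = 1) (h_zero : ∀ j ∉ T, ζ j = 0 ∨ ‖ξ j‖ < 1) :
    Tendsto (fun m => (ξ * ·)^[m] ζ) atTop (𝓝 (indicator hT)) := by
  refine tendsto_of_dominated (η := ζ) (fun j => ?_) (.of_forall fun m j => ?_)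
  · simp only [iterate_mul_apply]
    by_cases hj : j ∈ T
    · simp [h_one j hj, indicator_of_mem hT hj]
    · rw [indicator_of_notMem hT hj]
      rcases h_zero j hj with hζ | hξ
      · simp [hζ]
      · simpa using (tendsto_pow_atTop_nhds_zero_of_norm_lt_one hξ).mul_const (ζ j)
  · rw [iterate_mul_apply, norm_mul, norm_pow]
    by_cases hj : j ∈ T
    · simp [h_one j hj]
    · rcases h_zero j hj with hζ | hξ
      · simp [hζ]
      · exact mul_le_of_le_one_left (norm_nonneg _) (pow_le_one₀ (norm_nonneg _) hξ.le)

/-! ### Blocks of indices that a subalgebra does not separate -/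

section Blocks

/-- The indices at which some element of `E` does not vanish. -/
def support (E : NonUnitalSubalgebra ℂ RapidSeq) : Set ℕ+ := {j | ∃ ξ ∈ E, ξ j ≠ 0}

/-- The block of `j`: the indices that `E` does not separate from `j`. -/
def block (E : NonUnitalSubalgebra ℂ RapidSeq) (j : ℕ+) : Set ℕ+ := {i | ∀ ξ ∈ E, ξ i = ξ j}

variable {E : NonUnitalSubalgebra ℂ RapidSeq} {i j : ℕ+}

theorem mem_block_self : j ∈ block E j := fun _ _ => rfl

theorem block_eq_of_mem (hi : i ∈ block E j) : block E i = block E j :=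
  Set.ext fun _ => forall₂_congr fun ξ hξ => by rw [hi ξ hξ]

theorem mem_support_of_mem_block (hi : i ∈ block E j) (hj : j ∈ support E) : i ∈ support E := by
  obtain ⟨ξ, hξ, hne⟩ := hj
  exact ⟨ξ, hξ, by rwa [hi ξ hξ]⟩

theorem finite_block (hj : j ∈ support E) : (block E j).Finite := by
  obtain ⟨ξ, hξ, hne⟩ := hj
  exact (finite_le_norm ξ (norm_pos_iff.2 hne)).subset fun i hi => by simp [hi ξ hξ]

theorem exists_mem_apply_eq_one (hj : j ∈ support E) : ∃ ξ ∈ E, ξ j = 1 := by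
  obtain ⟨ξ, hξ, hne⟩ := hj
  exact ⟨(ξ j)⁻¹ • ξ, SMulMemClass.smul_mem _ hξ, inv_mul_cancel₀ hne⟩

theorem exists_mem_apply_eq_one_eqOn_zero (hj : j ∈ support E) {F : Set ℕ+} (hF : F.Finite)
    (hdisj : Disjoint F (block E j)) : ∃ ζ ∈ E, ζ j = 1 ∧ ∀ i ∈ F, ζ i = 0 := by
  induction F, hF using Set.Finite.induction_on with
  | empty =>
    obtain ⟨ξ, hξ, hξj⟩ := exists_mem_apply_eq_one hj
    exact ⟨ξ, hξ, hξj, fun i hi => hi.elim⟩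
  | @insert k F _ _ ih =>
    obtain ⟨hk, hdisjF⟩ := Set.disjoint_insert_left.1 hdisj
    obtain ⟨ζ, hζ, hζj, hζF⟩ := ih hdisjF
    obtain ⟨η, hη, hne⟩ : ∃ η ∈ E, η k ≠ η j := by simpa [block] using hk
    refine ⟨(η j - η k)⁻¹ • (η * ζ - η k • ζ), SMulMemClass.smul_mem _
      (sub_mem (mul_mem hη hζ) (SMulMemClass.smul_mem _ hζ)), ?_, ?_⟩
    · simp [hζj, sub_ne_zero.2 hne.symm]
    · rintro i (rfl | hi)
      · simp
      · simp [hζF i hi]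

/-- With `ξ j = 1` and `ζ j = 1`, where `ζ` kills the finitely many `i ∉ block E j` with
`1 ≤ ‖ξ i‖`, the products `ξ ^ m * ζ` converge to the indicator. -/
theorem indicator_block_mem (hE : IsClosed (E : Set RapidSeq)) (hj : j ∈ support E) :
    indicator (finite_block hj) ∈ E := by
  obtain ⟨ξ, hξ, hξj⟩ := exists_mem_apply_eq_one hj
  obtain ⟨ζ, hζ, hζj, hζF⟩ := exists_mem_apply_eq_one_eqOn_zero hj
    ((finite_le_norm ξ one_pos).sdiff (t := block E j)) Set.disjoint_sdiff_left
  have hlim := tendsto_iterate_mul_indicator (finite_block hj)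
    (fun i hi => ⟨(hi ξ hξ).trans hξj, (hi ζ hζ).trans hζj⟩)
    (fun i hi => or_iff_not_imp_right.2 fun hlt => hζF i ⟨not_lt.1 hlt, hi⟩)
  have hmaps : Set.MapsTo (ξ * ·) (E : Set RapidSeq) E := fun _ hη => mul_mem hξ hη
  exact hE.mem_of_tendsto hlim (.of_forall fun m => hmaps.iterate m hζ)

end Blocks

/-! ### Algebras of sequences constant on blocks -/

/-- A partial retraction `r` of the indices with `j ≤ r j`. It encodes a family of disjoint finite
blocks, the nonempty fibres of `r`, by sending each index to the largest element of its block; the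
value `none` marks the indices outside all blocks. -/
structure IsBlockMap (r : ℕ+ → Option ℕ+) : Prop where
  le : ∀ {j k}, r j = some k → j ≤ k
  idem : ∀ {j k}, r j = some k → r k = some k

/-- The largest elements of the blocks encoded by `r`. -/
def representatives (r : ℕ+ → Option ℕ+) : Set ℕ+ := {k | r k = some k}

/-- The `*`-subalgebra of the sequences which vanish where `r` is `none` and otherwise take the same
value at `j` and at `r j`. -/
def blockAlgebra (r : ℕ+ → Option ℕ+) : NonUnitalStarSubalgebra ℂ RapidSeq where
  carrier := {ξ | ∀ j, ξ j = (r j).elim 0 ξ}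
  zero_mem' j := by cases r j <;> rfl
  add_mem' {ξ η} hξ hη j := by
    rw [add_apply, hξ j, hη j]
    cases r j
    exacts [add_zero 0, rfl]
  mul_mem' {ξ η} hξ hη j := by
    rw [mul_apply, hξ j, hη j]
    cases r j
    exacts [mul_zero 0, rfl]
  smul_mem' c ξ hξ j := by
    rw [smul_apply, hξ j]
    cases r j
    exacts [mul_zero c, rfl]
  star_mem' {ξ} hξ j := by
    rw [star_apply, hξ j]
    cases r j
    exacts [star_zero ℂ, rfl]

section BlockAlgebra

variable {r : ℕ+ → Option ℕ+}

theorem apply_eq_zero_of_mem_blockAlgebra {ξ : RapidSeq} (hξ : ξ ∈ blockAlgebra r) {j : ℕ+}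
    (hj : r j = none) : ξ j = 0 := by
  rw [hξ j, hj, Option.elim_none]

theorem apply_eq_of_mem_blockAlgebra {ξ : RapidSeq} (hξ : ξ ∈ blockAlgebra r) {j k : ℕ+}
    (hj : r j = some k) : ξ j = ξ k := by
  rw [hξ j, hj, Option.elim_some]

theorem isClosed_blockAlgebra (r : ℕ+ → Option ℕ+) :
    IsClosed (blockAlgebra r : Set RapidSeq) := by
  have heq : (blockAlgebra r : Set RapidSeq) = ⋂ j, {ξ : RapidSeq | ξ j = (r j).elim 0 ξ} := by
    ext ξ
    rw [Set.mem_iInter]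
    rfl
  rw [heq]
  refine isClosed_iInter fun j => isClosed_eq (continuous_apply j) ?_
  cases r j with
  | none => exact continuous_const
  | some k => exact continuous_apply k

theorem exists_isBlockMap_representatives_eq (T : Set ℕ+) :
    ∃ r, IsBlockMap r ∧ representatives r = T := by
  classical
  refine ⟨fun j => if j ∈ T then some j else none, ⟨?_, ?_⟩, ?_⟩
  · simp +contextual
  · simp +contextual
  · ext k
    simp [representatives]

namespace IsBlockMap

variable (hr : IsBlockMap r)
include hr

theorem finite_fiber (k : ℕ+) : {j | r j = some k}.Finite :=
  (Set.finite_Iic k).subset fun _ hj => hr.le hj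

theorem indicator_fiber_mem (k : ℕ+) :
    indicator (hr.finite_fiber k) ∈ blockAlgebra r := fun j => by
  cases hj : r j with
  | none => exact indicator_of_notMem _ (by simp [hj])
  | some m =>
    have hm := hr.idem hj
    rw [Option.elim_some]
    by_cases hmk : m = k
    · subst hmk
      rw [indicator_of_mem _ hj, indicator_of_mem _ hm]
    · rw [indicator_of_notMem _ (by simpa [hj] using hmk),
        indicator_of_notMem _ (by simpa [hm] using hmk)]

theorem hasSum_indicator_fiber {ξ : RapidSeq} (hξ : ξ ∈ blockAlgebra r) :
    HasSum (fun k : representatives r => ξ k • indicator (hr.finite_fiber k)) ξ := by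
  classical
  have hterm (j : ℕ+) (k : representatives r) :
      (ξ k • indicator (hr.finite_fiber k)) j = if r j = some ↑k then ξ j else 0 := by
    rw [smul_apply]
    split_ifs with hj
    · rw [indicator_of_mem _ hj, mul_one, apply_eq_of_mem_blockAlgebra hξ hj]
    · rw [indicator_of_notMem _ hj, mul_zero]
  refine hasSum_of_hasSum_apply (η := ξ) (fun j => ?_) fun j => ?_
  all_goals
    simp only [hterm, apply_ite norm, norm_zero]
    cases hj : r j with
    | none => simp [apply_eq_zero_of_mem_blockAlgebra hξ hj]
    | some m =>
      convert hasSum_ite_eq (⟨m, hr.idem hj⟩ : representatives r) _ using 3 with k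
      rw [Option.some_inj, Subtype.ext_iff, eq_comm]

theorem finiteDimensional_blockAlgebra_iff :
    FiniteDimensional ℂ (blockAlgebra r) ↔ (representatives r).Finite := by
  constructor
  · intro hfin
    let e (k : representatives r) : blockAlgebra r := ⟨_, hr.indicator_fiber_mem k⟩
    let ev (k : representatives r) : blockAlgebra r →ₗ[ℂ] ℂ :=
      evalₗ k ∘ₗ (blockAlgebra r).toNonUnitalSubalgebra.toSubmodule.subtype
    have he : LinearIndependent ℂ e := .of_pairwise_dual_eq_zero_one e ev
      (fun i k hik => indicator_of_notMem (hr.finite_fiber k) fun hi =>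
        hik (Subtype.ext (Option.some_inj.1 (i.2.symm.trans hi))))
      (fun k => indicator_of_mem (hr.finite_fiber k) k.2)
    exact Set.finite_coe_iff.1 he.finite
  · intro hfin
    have := hfin.to_subtype
    let values : blockAlgebra r →ₗ[ℂ] (representatives r → ℂ) := LinearMap.pi fun k =>
      evalₗ k ∘ₗ (blockAlgebra r).toNonUnitalSubalgebra.toSubmodule.subtype
    refine .of_injective values fun ξ η hξη => Subtype.ext (ext fun j => ?_)
    cases hj : r j with
    | none =>
      rw [apply_eq_zero_of_mem_blockAlgebra ξ.2 hj, apply_eq_zero_of_mem_blockAlgebra η.2 hj]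
    | some k =>
      rw [apply_eq_of_mem_blockAlgebra ξ.2 hj, apply_eq_of_mem_blockAlgebra η.2 hj]
      exact congrFun hξη ⟨k, hr.idem hj⟩

end IsBlockMap

end BlockAlgebra

/-! ### Closed subalgebras are block algebras -/

section BlockMap

variable (E : NonUnitalSubalgebra ℂ RapidSeq)

open Classical in
/-- The block map of the subalgebra `E`, which sends the indices in the support of `E` to the
largest element of their block. -/
noncomputable def blockMap (j : ℕ+) : Option ℕ+ :=
  if hj : j ∈ support E then
    some ((finite_block hj).toFinset.max' ⟨j, (finite_block hj).mem_toFinset.2 mem_block_self⟩)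
  else none

variable {E} {j k : ℕ+}

theorem blockMap_eq_none_iff : blockMap E j = none ↔ j ∉ support E := by
  simp [blockMap]

theorem blockMap_eq_some_iff :
    blockMap E j = some k ↔ j ∈ support E ∧ IsGreatest (block E j) k := by
  by_cases hj : j ∈ support E
  · have hmax := (finite_block hj).toFinset.isGreatest_max'
      ⟨j, (finite_block hj).mem_toFinset.2 mem_block_self⟩
    rw [Set.Finite.coe_toFinset] at hmax
    simp only [blockMap, hj, dite_true, Option.some_inj, true_and]
    exact ⟨fun h => h ▸ hmax, hmax.unique⟩
  · simp [blockMap, hj]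

theorem isBlockMap_blockMap (E : NonUnitalSubalgebra ℂ RapidSeq) : IsBlockMap (blockMap E) where
  le hj := (blockMap_eq_some_iff.1 hj).2.2 mem_block_self
  idem hj := by
    obtain ⟨hsupp, hmax⟩ := blockMap_eq_some_iff.1 hj
    exact blockMap_eq_some_iff.2
      ⟨mem_support_of_mem_block hmax.1 hsupp, by rwa [block_eq_of_mem hmax.1]⟩

theorem fiber_blockMap (hk : k ∈ representatives (blockMap E)) :
    {j | blockMap E j = some k} = block E k := by
  obtain ⟨hsupp, hmax⟩ := blockMap_eq_some_iff.1 hk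
  ext j
  refine ⟨fun hj => ?_, fun hj => blockMap_eq_some_iff.2
    ⟨mem_support_of_mem_block hj hsupp, by rwa [block_eq_of_mem hj]⟩⟩
  rw [block_eq_of_mem (blockMap_eq_some_iff.1 hj).2.1]
  exact mem_block_self

theorem blockAlgebra_blockMap (hE : IsClosed (E : Set RapidSeq)) :
    (blockAlgebra (blockMap E)).toNonUnitalSubalgebra = E := by
  refine le_antisymm (fun ξ hξ => ?_) fun ξ hξ j => ?_
  · refine hE.mem_of_tendsto ((isBlockMap_blockMap E).hasSum_indicator_fiber hξ)
      (.of_forall fun t => sum_mem fun k _ => SMulMemClass.smul_mem _ ?_)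
    simp only [fiber_blockMap k.2]
    exact indicator_block_mem hE (blockMap_eq_some_iff.1 k.2).1
  · cases hj : blockMap E j with
    | none =>
      by_contra hne
      exact blockMap_eq_none_iff.1 hj ⟨ξ, hξ, hne⟩
    | some k => exact ((blockMap_eq_some_iff.1 hj).2.1 ξ hξ).symm

end BlockMap

/-! ### Restriction to a subsequence and extension from it -/

section Extension

/-- The restriction `ξ ↦ (ξ (n k))ₖ` as a map from `s` to `λ^∞(n_k^q)`. -/
def restrict (n : ℕ+ → ℕ+) : RapidSeq →ₗ[ℂ] LambdaInf (KotheMatrix.powers n) where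
  toFun ξ := ⟨fun k => ξ (n k), fun q => ⟨seminorm q ξ, by
    rintro _ ⟨k, rfl⟩
    exact norm_mul_pow_le_seminorm q ξ (n k)⟩⟩
  map_add' _ _ := rfl
  map_smul' _ _ := rfl

theorem continuous_restrict (n : ℕ+ → ℕ+) : Continuous (restrict n) := by
  refine continuous_of_seminorm_le withSeminorms LambdaInf.withSeminorms _
    fun q => ⟨q, 1, fun ξ => ?_⟩
  rw [one_mul]
  exact ciSup_le fun k => norm_mul_pow_le_seminorm q ξ (n k)

variable {n : ℕ+ → ℕ+} {κ : ℕ+ → Option ℕ+}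

theorem norm_elim_mul_pow_le (hκ : ∀ j k, κ j = some k → j ≤ n k)
    (η : LambdaInf (KotheMatrix.powers n)) (q : ℕ) (j : ℕ+) :
    ‖(κ j).elim 0 η‖ * (j : ℝ) ^ q ≤ LambdaInf.seminorm _ q η := by
  cases hj : κ j with
  | none => simp
  | some k =>
    have hle : (j : ℝ) ≤ n k := by exact_mod_cast hκ j k hj
    calc ‖η k‖ * (j : ℝ) ^ q ≤ ‖η k‖ * (n k : ℝ) ^ q := by gcongr
      _ ≤ _ := LambdaInf.norm_mul_entry_le_seminorm q η k

/-- The extension of `η ∈ λ^∞(n_k^q)` to the sequence with value `η k` where `κ j = some k` and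
zero where `κ j` is `none`. -/
def extend (hκ : ∀ j k, κ j = some k → j ≤ n k) :
    LambdaInf (KotheMatrix.powers n) →ₗ[ℂ] RapidSeq where
  toFun η := ⟨fun j => (κ j).elim 0 η,
    mem_carrier_of_norm_mul_pow_le fun q => ⟨_, norm_elim_mul_pow_le hκ η q⟩⟩
  map_add' η η' := ext fun j => by
    change (κ j).elim 0 _ = (κ j).elim 0 η + (κ j).elim 0 η'
    cases κ j
    exacts [(add_zero 0).symm, rfl]
  map_smul' c η := ext fun j => by
    change (κ j).elim 0 _ = c * (κ j).elim 0 η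
    cases κ j
    exacts [(mul_zero c).symm, rfl]

theorem extend_apply (hκ : ∀ j k, κ j = some k → j ≤ n k)
    (η : LambdaInf (KotheMatrix.powers n)) (j : ℕ+) : extend hκ η j = (κ j).elim 0 η := rfl

theorem continuous_extend (hκ : ∀ j k, κ j = some k → j ≤ n k) : Continuous (extend hκ) :=
  continuous_of_seminorm_le LambdaInf.withSeminorms withSeminorms _ fun q => ⟨q + 1, _, fun η =>
    seminorm_le_of_norm_mul_pow_le (apply_nonneg _ _) (norm_elim_mul_pow_le hκ η (q + 1))⟩

variable {r : ℕ+ → Option ℕ+}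

theorem IsBlockMap.le_of_map_eq (hr : IsBlockMap r) (hκr : ∀ j, (κ j).map n = r j) (j k : ℕ+)
    (hj : κ j = some k) : j ≤ n k :=
  hr.le (by rw [← hκr, hj, Option.map_some])

theorem extend_restrict (hκ : ∀ j k, κ j = some k → j ≤ n k) (hκr : ∀ j, (κ j).map n = r j)
    {ξ : RapidSeq} (hξ : ξ ∈ blockAlgebra r) : extend hκ (restrict n ξ) = ξ := ext fun j => by
  rw [extend_apply, hξ j, ← hκr]
  cases κ j <;> rfl

theorem extend_apply_of_map_eq_some (hκ : ∀ j k, κ j = some k → j ≤ n k) (hn : n.Injective)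
    (η : LambdaInf (KotheMatrix.powers n)) {j k : ℕ+} (hj : (κ j).map n = some (n k)) :
    extend hκ η j = η k := by
  have hk : κ j = some k := Option.map_injective hn (by rw [hj, Option.map_some])
  rw [extend_apply, hk, Option.elim_some]

theorem restrict_extend (hκ : ∀ j k, κ j = some k → j ≤ n k) (hn : n.Injective)
    (hκn : ∀ k, (κ (n k)).map n = some (n k)) (η : LambdaInf (KotheMatrix.powers n)) :
    restrict n (extend hκ η) = η :=
  LambdaInf.ext fun k => extend_apply_of_map_eq_some hκ hn η (hκn k)

theorem IsBlockMap.extend_mem_blockAlgebra (hr : IsBlockMap r)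
    (hκ : ∀ j k, κ j = some k → j ≤ n k) (hn : n.Injective) (hκr : ∀ j, (κ j).map n = r j)
    (η : LambdaInf (KotheMatrix.powers n)) : extend hκ η ∈ blockAlgebra r := fun j => by
  rw [← hκr, extend_apply]
  cases hj : κ j with
  | none => rfl
  | some k =>
    refine (extend_apply_of_map_eq_some hκ hn η ?_).symm
    rw [hκr]
    exact hr.idem (by rw [← hκr, hj, Option.map_some])

theorem IsBlockMap.closedComplemented (hr : IsBlockMap r) :
    (blockAlgebra r).toNonUnitalSubalgebra.toSubmodule.ClosedComplemented := by
  have hκ : ∀ j k, r j = some k → j ≤ id k := fun _ _ => hr.le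
  have hκr : ∀ j, (r j).map id = r j := fun _ => Option.map_id_apply
  let P : RapidSeq →L[ℂ] RapidSeq :=
    ⟨extend hκ ∘ₗ restrict id, (continuous_extend hκ).comp (continuous_restrict id)⟩
  have hP : ∀ ξ, P ξ ∈ (blockAlgebra r).toNonUnitalSubalgebra.toSubmodule := fun ξ =>
    hr.extend_mem_blockAlgebra hκ Function.injective_id hκr (restrict id ξ)
  exact ⟨P.codRestrict _ hP, fun ξ => Subtype.ext (extend_restrict hκ hκr ξ.2)⟩

theorem IsBlockMap.frechetStarIso (hr : IsBlockMap r) (hn : n.Injective)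
    (hrange : Set.range n = representatives r) :
    FrechetStarIso (blockAlgebra r) (LambdaInf (KotheMatrix.powers n)) := by
  let κ (j : ℕ+) : Option ℕ+ := (r j).map (Function.invFun n)
  have hκr : ∀ j, (κ j).map n = r j := fun j => by
    cases hj : r j with
    | none => simp [κ, hj]
    | some k =>
      have hk : k ∈ Set.range n := hrange ▸ hr.idem hj
      simp [κ, hj, Function.invFun_eq hk]
  have hκn : ∀ k, (κ (n k)).map n = some (n k) := fun k =>
    (hκr (n k)).trans (hrange.subset (Set.mem_range_self k))
  have hκ := hr.le_of_map_eq hκr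
  have hmem := hr.extend_mem_blockAlgebra hκ hn hκr
  let Φ : blockAlgebra r ≃⋆ₐ[ℂ] LambdaInf (KotheMatrix.powers n) :=
    { toFun ξ := restrict n ξ
      invFun η := ⟨extend hκ η, hmem η⟩
      left_inv ξ := Subtype.ext (extend_restrict hκ hκr ξ.2)
      right_inv := restrict_extend hκ hn hκn
      map_mul' _ _ := rfl
      map_add' _ _ := rfl
      map_star' _ := rfl
      map_smul' _ _ := rfl }
  exact ⟨Φ, (continuous_restrict n).comp continuous_subtype_val,
    (continuous_extend hκ).subtype_mk hmem⟩

end Extension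

end RapidSeq

open RapidSeq

theorem mainTheorem6_general :
    (∀ E : NonUnitalSubalgebra ℂ RapidSeq,
      IsClosed (E : Set RapidSeq) → ¬ FiniteDimensional ℂ E →
        ∃ F : NonUnitalStarSubalgebra ℂ RapidSeq, F.toNonUnitalSubalgebra = E ∧
          ∃ n : ℕ+ → ℕ+, StrictMono n ∧ FrechetStarIso F (LambdaInf (KotheMatrix.powers n))) ∧
    (∀ n : ℕ+ → ℕ+, n.Injective →
      ∃ E : NonUnitalStarSubalgebra ℂ RapidSeq,
        IsClosed (E : Set RapidSeq) ∧ ¬ FiniteDimensional ℂ E ∧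
          FrechetStarIso (LambdaInf (KotheMatrix.powers n)) E) ∧
    (∀ E : NonUnitalSubalgebra ℂ RapidSeq,
      IsClosed (E : Set RapidSeq) → E.toSubmodule.ClosedComplemented) := by
  refine ⟨fun E hE hfin => ?_, fun n hn => ?_, fun E hE => ?_⟩
  · have hr := isBlockMap_blockMap E
    have hEr := blockAlgebra_blockMap hE
    rw [← hEr] at hfin
    obtain ⟨n, hn, hrange⟩ :=
      exists_strictMono_range_eq (mt hr.finiteDimensional_blockAlgebra_iff.2 hfin)
    exact ⟨_, hEr, n, hn, hr.frechetStarIso hn.injective hrange⟩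
  · obtain ⟨r, hr, hrange⟩ := exists_isBlockMap_representatives_eq (Set.range n)
    obtain ⟨Φ, hΦ, hΦ'⟩ := hr.frechetStarIso hn hrange.symm
    refine ⟨blockAlgebra r, isClosed_blockAlgebra r, ?_, Φ.symm, hΦ', hΦ⟩
    rw [hr.finiteDimensional_blockAlgebra_iff, hrange]
    exact Set.infinite_range_of_injective hn
  · rw [← blockAlgebra_blockMap hE]
    exact (isBlockMap_blockMap E).closedComplemented

theorem mainTheorem6 :
    (∀ E : NonUnitalStarSubalgebra ℂ RapidSeq,
      IsClosed (E : Set RapidSeq) → ¬ FiniteDimensional ℂ E →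
        ∃ n : ℕ+ → ℕ+, StrictMono n ∧ FrechetStarIso E (LambdaInf (KotheMatrix.powers n))) ∧
    (∀ n : ℕ+ → ℕ+, StrictMono n →
      ∃ E : NonUnitalStarSubalgebra ℂ RapidSeq,
        IsClosed (E : Set RapidSeq) ∧ ¬ FiniteDimensional ℂ E ∧
          FrechetStarIso (LambdaInf (KotheMatrix.powers n)) E) ∧
    (∀ E : NonUnitalStarSubalgebra ℂ RapidSeq,
      IsClosed (E : Set RapidSeq) →
        E.toNonUnitalSubalgebra.toSubmodule.ClosedComplemented) := by
  obtain ⟨h₁, h₂, h₃⟩ := mainTheorem6_general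
  refine ⟨fun E hE hfin => ?_, fun n hn => h₂ n hn.injective, fun E => h₃ E.toNonUnitalSubalgebra⟩
  obtain ⟨F, hF, hiso⟩ := h₁ E.toNonUnitalSubalgebra hE hfin
  rwa [NonUnitalStarSubalgebra.toNonUnitalSubalgebra_injective hF] at hiso
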